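/- **Problems.** In *set intersection* the input consists of finite sets $S_1,\dots,S_m$ over a finite universe $\mathcal U$ with $\sum_i |S_i| = n$; the answer set of a query $(i,j)$ is $S_i\cap S_j$. In *common colors* the input is an array of $n$ colors from a finite universe $\mathcal U$; a query consists of two intervals of positions, and its answer set is the set of colors that appear in both intervals. The *reporting* variant asks for all elements of the answer set; in the *searching* variant every $x\in\mathcal U$ carries a weight $w(x)$ from a commutative semi-group $G$, and the query asks for the sum of $w(x)$ over the answer set. **Pointer machine.** A data structure is a directed graph of out-degree at most two with a root, each vertex storing at most one element of $\mathcal U$; its space is the number of vertices. To answer a query with answer set $A$, it explores a set of vertices that contains the root, in which every vertex is reached from the root along pointers inside the set, and which stores every element of $A$; its query time is the number of explored vertices. **Semi-group model.** A data structure stores precomputed sums $s_i=\sum_{x\in I_i}\alpha_{i,x}w(x)$, with integers $\alpha_{i,x}\ge 1$ and with sets $I_i\subseteq\mathcal U$ independent of $w$; its space is the number of these sums. For every query it picks a set of stored sums, independent of $w$, such that for every $w$ the answer is a combination of the picked sums with positive integer multiplicities; its query time is the number of picked sums. The integers ($\alpha_{i,x}$ and the multiplicities) are either (a) independent of $w$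 or (b) allowed to depend on $w$. $G$ is *faithful* if, whenever $I,I'$ are finite sets of variables and $\sum_{i\in I}\alpha_i g_i=\sum_{i\in I'}\alpha'_i g_i$ for every assignment $g$ of elements of $G$ to the variables, with constant integers $\alpha_i\ge1$ and integers $\alpha_i'\ge 1$ that are constants in case (a) and may depend on $g$ in case (b), then $I=I'$. (An empty sum differs from all elements of $G$.) **Corollary.** Consider either of the two problems, set intersection or common colors. 1. (Reporting, pointer machine.) For every $\alpha\ge 0$ there are constants $c,C>0$ and $N$, depending only on $\alpha$, such that: if for all $n$ every input of size $n$ has a pointer machine data structure with space at most $S(n)$ that answers every query in time at most $Q(n)+\alpha t$, where $t$ is the size of the answer set, then for all $n\ge N$ $$S(n)\,Q(n)\ \ge\ c\,\frac{n^2}{2^{C\sqrt{\log_2 (n/Q(n))}}\,\log_2^2 n},$$ where the square root is read as $0$ if $Q(n)>n$. 2. (Searching, semi-group model.) There are absolute constants $c>0$ and $N$ such that, in each of the cases (a) and (b) and for every faithful commutative semi-group $G$: if for all $n$ every input of size $n$ has a data structure in the semi-group model over $G$ with space at most $S(n)$ and query time at most $Q(n)$, then for all $n\ge N$ $$S(n)\,Q(n)^2\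 \ge\ c\,\frac{n^2}{\log_2^4 n}.$$ -/

import Mathlib

/-! ## The two problems

Both are given by a finite universe `Fin u` and, for every query, the set of universe elements that
match the query. -/

/-- Set intersection: the input is a list of sets `A 0, …, A (m-1)` over the universe `Fin u`; the
query `(i, j)` asks for `A i ∩ A j`. -/
def setIntersection {u m : ℕ} (A : Fin m → Finset (Fin u)) (q : Fin m × Fin m) : Finset (Fin u) :=
  A q.1 ∩ A q.2

/-- Common colors: the input is an array `a` of length `n` of colors from `Fin u`; the query
`((l, r), (l', r'))` asks for the colors occurring both in `a[l..r]` and in `a[l'..r']`. -/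
def commonColors {u n : ℕ} (a : Fin n → Fin u) (q : (Fin n × Fin n) × (Fin n × Fin n)) :
    Finset (Fin u) :=
  (Finset.Icc q.1.1 q.1.2).image a ∩ (Finset.Icc q.2.1 q.2.2).image a

/-! ## The pointer machine model -/

/-- A pointer machine data structure over the universe `U`: a directed graph whose vertices are
memory cells, with a root, at most two outgoing pointers per cell, and at most one element of `U`
stored in each cell. -/
structure PointerMachine (U : Type*) where
  size : ℕ
  root : Fin size
  next : Fin size → Bool → Option (Fin size)
  cell : Fin size → Option U

/-- `W` can be explored by starting at the root and following pointers: it contains the root, and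
each of its vertices is reached from the root along pointers between vertices of `W`. -/
def PointerMachine.Explorable {U : Type*} (D : PointerMachine U) (W : Finset (Fin D.size)) : Prop :=
  D.root ∈ W ∧
    ∀ v ∈ W, Relation.ReflTransGen
      (fun x y => x ∈ W ∧ y ∈ W ∧ ∃ b, D.next x b = some y) D.root v

/-- `D` can report all elements of `A` in time at most `time`, the number of explored cells. -/
def PointerMachine.Reports {U : Type*} (D : PointerMachine U) (A : Finset U) (time : ℝ) : Prop :=
  ∃ W : Finset (Fin D.size), D.Explorable W ∧
    (∀ x ∈ A, ∃ v ∈ W, D.cell v = some x) ∧ (W.card : ℝ) ≤ time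

/-- The reporting problem with answer sets `ans` has a pointer machine data structure with at most
`space` cells and query time at most `overhead + α t`, where `t` is the output size. -/
def PointerMachineSolvable {U Q : Type*} (ans : Q → Finset U) (space overhead α : ℝ) : Prop :=
  ∃ D : PointerMachine U, (D.size : ℝ) ≤ space ∧
    ∀ q, D.Reports (ans q) (overhead + α * ((ans q).card : ℝ))

/-! ## The semi-group model

Sums over a semi-group `G` are evaluated in `WithZero G`, that is, in `G` with a formal zero added
that serves as the value of the empty sum. -/

/-- Whether the integer coefficients in the precomputed sums are fixed in advance or may depend on
the weight function. -/
inductive CoeffMode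
  | fixed
  | weightDependent

/-- The families of coefficients (as functions of the weight function) that are admitted. -/
def CoeffMode.Admits (μ : CoeffMode) {W A : Type*} (a : W → A) : Prop :=
  match μ with
  | .fixed => ∀ w w', a w = a w'
  | .weightDependent => True

/-- The semi-group `G` is faithful: if `∑ i ∈ I, a i • g i = ∑ j ∈ J, b j • g j` holds for every
assignment `g` of semi-group values to the variables, where all coefficients are positive
integers, then `I = J`. The coefficients `b` have the freedom that data structures are
given: they are constants, or may depend on the assignment `g`. -/
def Faithful (μ : CoeffMode) (G : Type*) [AddCommSemigroup G] : Prop :=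
  ∀ (k : ℕ) (I J : Finset (Fin k)) (a : Fin k → ℕ) (b : (Fin k → G) → Fin k → ℕ),
    (∀ i ∈ I, 0 < a i) → μ.Admits b → (∀ g, ∀ j ∈ J, 0 < b g j) →
    (∀ g : Fin k → G,
      ∑ i ∈ I, a i • (g i : WithZero G) = ∑ j ∈ J, b g j • (g j : WithZero G)) →
    I = J

/-- A storage scheme over the universe `U`: `size` many precomputed sums, the `i`-th one being
`∑ x ∈ supp i, coeff w i x • w x` for the weight function `w`, with positive coefficients. The set
`supp i` does not depend on the weights. -/
structure StorageScheme (μ : CoeffMode) (G U : Type*) where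
  size : ℕ
  supp : Fin size → Finset U
  coeff : (U → G) → Fin size → U → ℕ
  coeff_admits : μ.Admits coeff
  coeff_pos : ∀ w i, ∀ x ∈ supp i, 0 < coeff w i x

/-- The value of the `i`-th precomputed sum for the weight function `w`. -/
def StorageScheme.value {μ : CoeffMode} {G U : Type*} [AddCommSemigroup G]
    (D : StorageScheme μ G U) (w : U → G) (i : Fin D.size) : WithZero G :=
  ∑ x ∈ D.supp i, D.coeff w i x • (w x : WithZero G)

/-- `D` computes `∑ x ∈ A, w x` from at most `time` of its precomputed sums, each of which may be
taken with a positive integer multiplicity; which sums are picked does not depend on `w`. -/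
def StorageScheme.Computes {μ : CoeffMode} {G U : Type*} [AddCommSemigroup G]
    (D : StorageScheme μ G U) (A : Finset U) (time : ℝ) : Prop :=
  ∃ (T : Finset (Fin D.size)) (γ : (U → G) → Fin D.size → ℕ),
    (T.card : ℝ) ≤ time ∧ μ.Admits γ ∧ (∀ w, ∀ i ∈ T, 0 < γ w i) ∧
    ∀ w : U → G, ∑ i ∈ T, γ w i • D.value w i = ∑ x ∈ A, (w x : WithZero G)

/-- The searching problem with answer sets `ans` has a storage scheme over `G` with at most `space`
precomputed sums and query time at most `time`. -/
def SemigroupSolvable (μ : CoeffMode) (G : Type*) [AddCommSemigroup G] {U Q : Type*}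
    (ans : Q → Finset U) (space time : ℝ) : Prop :=
  ∃ D : StorageScheme μ G U, (D.size : ℝ) ≤ space ∧ ∀ q, D.Computes (ans q) time

/-! ## Worst-case complexity over all inputs of size `n` -/

/-- Every instance of set intersection of total size `n` can be solved in the pointer machine model
with space `s` and query time `q + α t`. -/
def SetIntersectionReporting (n : ℕ) (s q α : ℝ) : Prop :=
  ∀ (u m : ℕ) (A : Fin m → Finset (Fin u)), ∑ i, (A i).card = n →
    PointerMachineSolvable (setIntersection A) s q α

/-- Every instance of common colors with an array of length `n` can be solved in the pointer machine
model with space `s` and query time `q + α t`. -/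
def CommonColorsReporting (n : ℕ) (s q α : ℝ) : Prop :=
  ∀ (u : ℕ) (a : Fin n → Fin u), PointerMachineSolvable (commonColors a) s q α

/-- Every instance of set intersection of total size `n` can be solved in the semi-group model
over `G` with space `s` and query time `q`. -/
def SetIntersectionSearching (μ : CoeffMode) (G : Type*) [AddCommSemigroup G]
    (n : ℕ) (s q : ℝ) : Prop :=
  ∀ (u m : ℕ) (A : Fin m → Finset (Fin u)), ∑ i, (A i).card = n →
    SemigroupSolvable μ G (setIntersection A) s q

/-- Every instance of common colors with an array of length `n` can be solved in the semi-group
model over `G` with space `s` and query time `q`. -/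
def CommonColorsSearching (μ : CoeffMode) (G : Type*) [AddCommSemigroup G]
    (n : ℕ) (s q : ℝ) : Prop :=
  ∀ (u : ℕ) (a : Fin n → Fin u), SemigroupSolvable μ G (commonColors a) s q

/-! Both bounds come from one family of sets. The universe is a disjoint union of `t` square grids.
Each word of a code of length `t` defines a row set (one row per grid, chosen by the letters) and a
column set (one column per grid). A row set and a column set meet in exactly one point per grid. A
union bound (`exists_code`) gives a code in which fewer than `r` words match any `β` prescribed
letters, so any `β` elements lie in at most `r ^ 2` of the `m ^ 2` answer sets
(`exists_hardInstance`). The family can be embedded in an input of either problem.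

Reporting: an explored set is spanned by a binary tree. If its size is linear in the output size
`t`, cutting it into pieces of order `β` nodes leaves order `t / β` pieces that each hold `β` answer
elements (`exists_richRoots`). A piece is determined by its root cell and its shape, and there are
only `2 ^ O(β)` shapes, so a cell can serve at most `2 ^ O(β) * r ^ 2` queries. Double counting
gives `m ^ 2 * t ≤ S * r ^ 2 * 2 ^ O(β)` (`PointerMachine.card_mul_le_size_mul`). With alphabet `2 ^
k`, `m = 2 ^ h`, `β = 2 * k` and `r` about `log n`, the union bound works for `2 * k < h ≤ k ^ 2`.
Hence `k` is about `√(log (n / Q))`, and the alphabet and the shapes cost a factor `2 ^ O(k)`.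

Searching: by faithfulness the supports of the picked sums have the answer set as their union, so
one of them is a subset of size at least `t / Q`. No shapes are counted here, so `β` may be of order
`log m` and a binary alphabet suffices (`searching_tradeoff`). -/

/-! ## Binary trees inside graphs of out-degree two -/

section Cover

variable {V : Type*} [DecidableEq V] (next : V → Bool → Option V)

/-- The vertices visited when the binary tree shape `T` is followed from `o` along pointers. -/
def BinaryTree.cover : BinaryTree Unit → Option V → Finset V
  | .nil, _ => ∅
  | .node _ _ _, none => ∅
  | .node _ l r, some v => insert v (l.cover (next v false) ∪ r.cover (next v true))

namespace BinaryTree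

@[simp] theorem cover_nil (o : Option V) : cover next nil o = ∅ := by cases o <;> rfl

@[simp] theorem cover_none (T : BinaryTree Unit) : cover next T none = ∅ := by cases T <;> rfl

@[simp] theorem cover_node (x : Unit) (l r : BinaryTree Unit) (v : V) :
    cover next (node x l r) (some v) =
      insert v (cover next l (next v false) ∪ cover next r (next v true)) := rfl

theorem card_cover_le (T : BinaryTree Unit) (o : Option V) :
    (cover next T o).card ≤ T.numNodes := by
  induction T generalizing o with
  | nil => simp
  | node x l r hl hr =>
    cases o with
    | none => simp
    | some v =>
      have h1 := Finset.card_insert_le v (cover next l (next v false) ∪ cover next r (next v true))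
      have h2 := Finset.card_union_le (cover next l (next v false)) (cover next r (next v true))
      have := hl (next v false)
      have := hr (next v true)
      simp only [cover_node, numNodes]
      omega

/-- If following a shape meets no vertex twice, then the same holds for both subtrees, and they
are disjoint and avoid the root. -/
theorem card_cover_node {x : Unit} {l r : BinaryTree Unit} {v : V}
    (h : (cover next (node x l r) (some v)).card = (node x l r).numNodes) :
    (cover next l (next v false)).card = l.numNodes ∧
      (cover next r (next v true)).card = r.numNodes ∧
      Disjoint (cover next l (next v false)) (cover next r (next v true)) ∧
      v ∉ cover next l (next v false) ∪ cover next r (next v true) := by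
  have h1 := Finset.card_insert_le v (cover next l (next v false) ∪ cover next r (next v true))
  have h2 := Finset.card_union_le (cover next l (next v false)) (cover next r (next v true))
  have h3 := card_cover_le next l (next v false)
  have h4 := card_cover_le next r (next v true)
  simp only [cover_node, numNodes] at h
  refine ⟨by omega, by omega, ?_, fun hv => ?_⟩
  · rw [← Finset.card_union_eq_card_add_card]; omega
  · rw [Finset.insert_eq_of_mem hv] at h; omega

/-- A shape can be extended along a pointer that leaves its cover. -/
theorem exists_cover_insert {x y : V} {b : Bool} (hxy : next x b = some y) (T : BinaryTree Unit)
    (o : Option V) (hx : x ∈ cover next T o) (hy : y ∉ cover next T o) :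
    ∃ T' : BinaryTree Unit, T'.numNodes = T.numNodes + 1 ∧
      cover next T' o = insert y (cover next T o) := by
  induction T generalizing o with
  | nil => simp at hx
  | node z l r hl hr =>
    cases o with
    | none => simp at hx
    | some v =>
      simp only [cover_node, Finset.mem_insert, Finset.mem_union, not_or] at hx hy
      obtain ⟨-, hyl, hyr⟩ := hy
      rcases hx with rfl | hx | hx
      -- At `x` itself, slot `b` of the shape must be empty: otherwise `y` would already be covered.
      · cases b with
        | false =>
          cases l with
          | nil =>
            refine ⟨node z (node () nil nil) r, by simp only [numNodes]; omega, ?_⟩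
            simp only [cover_node, hxy, cover_nil]
            ext; simp; tauto
          | node _ _ _ => simp [hxy] at hyl
        | true =>
          cases r with
          | nil =>
            refine ⟨node z l (node () nil nil), by simp only [numNodes], ?_⟩
            simp only [cover_node, hxy, cover_nil]
            ext; simp; tauto
          | node _ _ _ => simp [hxy] at hyr
      · obtain ⟨l', hl1, hl2⟩ := hl _ hx hyl
        refine ⟨node z l' r, by simp only [numNodes]; omega, ?_⟩
        simp only [cover_node, hl2]
        ext; simp; tauto
      · obtain ⟨r', hr1, hr2⟩ := hr _ hx hyr
        refine ⟨node z l r', by simp only [numNodes]; omega, ?_⟩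
        simp only [cover_node, hr2]
        ext; simp; tauto

/-- The number of shapes with fewer than `s` nodes is at most `4 ^ s`. -/
theorem card_shapes_le (s : ℕ) :
    ((Finset.range s).biUnion treesOfNumNodesEq).card ≤ 4 ^ s := by
  have h : ∀ n, (treesOfNumNodesEq n).card ≤ 4 ^ n := fun n => by
    rw [treesOfNumNodesEq_card_eq_catalan, catalan_eq_centralBinom_div]
    refine (Nat.div_le_self _ _).trans ?_
    rw [Nat.centralBinom]
    refine (Nat.choose_le_two_pow _ _).trans (le_of_eq ?_)
    rw [pow_mul]; norm_num
  refine Finset.card_biUnion_le.trans ((Finset.sum_le_sum fun n _ => h n).trans ?_)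
  induction s with
  | zero => simp
  | succ s ih =>
    rw [Finset.sum_range_succ, pow_succ]
    omega

end BinaryTree

/-- An explorable set is covered by a shape that meets each of its vertices exactly once. -/
theorem PointerMachine.Explorable.exists_cover_eq {U : Type*} {D : PointerMachine U}
    {W : Finset (Fin D.size)} (hW : D.Explorable W) :
    ∃ T : BinaryTree Unit, T.numNodes = W.card ∧ T.cover D.next (some D.root) = W := by
  have key : ∀ k, k < W.card → ∃ T : BinaryTree Unit, T.numNodes = k + 1 ∧
      (T.cover D.next (some D.root)).card = k + 1 ∧ T.cover D.next (some D.root) ⊆ W ∧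
      D.root ∈ T.cover D.next (some D.root) := by
    intro k
    induction k with
    | zero =>
      intro _
      exact ⟨.node () .nil .nil, by simp [BinaryTree.numNodes], by simp, by simp [hW.1], by simp⟩
    | succ k ih =>
      intro hk
      obtain ⟨T, hT1, hT2, hT3, hT4⟩ := ih (by omega)
      -- If no pointer left the cover within `W`, induction along the paths from the root would put
      -- all of `W` into the cover.
      have hedge : ∃ x ∈ T.cover D.next (some D.root), ∃ y ∈ W,
          y ∉ T.cover D.next (some D.root) ∧ ∃ b, D.next x b = some y := by
        by_contra! hno
        have hsub : W ⊆ T.cover D.next (some D.root) := by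
          intro v hv
          have hp := hW.2 v hv
          clear hv
          induction hp with
          | refl => exact hT4
          | tail _ hbc ih' =>
            by_contra hc
            obtain ⟨_, hc', b, hb⟩ := hbc
            exact hno _ ih' _ hc' hc b hb
        have := Finset.card_le_card hsub
        omega
      obtain ⟨x, hx, y, hyW, hy, b, hb⟩ := hedge
      obtain ⟨T', h1, h2⟩ := T.exists_cover_insert D.next hb _ hx hy
      refine ⟨T', by omega, ?_, ?_, ?_⟩
      · rw [h2, Finset.card_insert_of_notMem hy, hT2]
      · rw [h2]; exact Finset.insert_subset hyW hT3
      · rw [h2]; exact Finset.mem_insert_of_mem hT4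
  have hpos : 0 < W.card := Finset.card_pos.2 ⟨_, hW.1⟩
  obtain ⟨T, h1, h2, h3, -⟩ := key (W.card - 1) (by omega)
  exact ⟨T, by omega, Finset.eq_of_subset_of_card_le h3 (by omega)⟩

/-! ## Decomposition into small trees holding many elements -/

variable {U : Type*} [DecidableEq U] (g : V → Finset U)

/-- `v` is the root of a shape with at most `s` nodes whose cover holds at least `β` elements. -/
def IsRichRoot (s β : ℕ) (v : V) : Prop :=
  ∃ T : BinaryTree Unit, T.numNodes ≤ s ∧ β ≤ ((T.cover next (some v)).biUnion g).card

-- Greedy cutting from the leaves upwards. `T'` is the part still attached to the root. Once it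
-- exceeds `s` nodes (it then has at most `2 * s + 1`) it is cut off. A rich piece adds its root to
-- `R` and accounts for at most `2 * s + 1` elements; a poor piece holds fewer than `β` elements,
-- charged to its more than `s` nodes at rate `β / s`. The inequality is this account multiplied by
-- `s`. Since no vertex is met twice, the roots found in the two subtrees are distinct.
open BinaryTree in
theorem exists_richRoots {s β : ℕ} (hg : ∀ v, (g v).card ≤ 1) (T : BinaryTree Unit)
    (o : Option V) (hT : (T.cover next o).card = T.numNodes) :
    ∃ (R : Finset V) (T' : BinaryTree Unit), R ⊆ T.cover next o ∧ T'.numNodes ≤ s ∧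
      (∀ v ∈ R, IsRichRoot next g (2 * s + 1) β v) ∧
      s * ((T.cover next o \ T'.cover next o).biUnion g).card + β * T'.numNodes ≤
        s * (2 * s + 1) * R.card + β * T.numNodes := by
  have hsub : ∀ X Y Z : Finset V, X ⊆ Y ∪ Z →
      (X.biUnion g).card ≤ (Y.biUnion g).card + (Z.biUnion g).card := fun X Y Z h => by
    refine (Finset.card_le_card (Finset.biUnion_subset_biUnion_of_subset_left g h)).trans ?_
    rw [Finset.union_biUnion]
    exact Finset.card_union_le _ _
  have hcard : ∀ X : Finset V, (X.biUnion g).card ≤ X.card := fun X => by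
    simpa using Finset.card_biUnion_le_card_mul X g 1 fun v _ => hg v
  induction T generalizing o with
  | nil => exact ⟨∅, nil, by simp, by simp [numNodes], by simp, by simp [numNodes]⟩
  | node x l r hl hr =>
    cases o with
    | none => simp [numNodes] at hT
    | some v =>
      obtain ⟨hcl, hcr, hdis, hv⟩ := card_cover_node next hT
      obtain ⟨Rl, l', hRl, hnl, hgl, hel⟩ := hl _ hcl
      obtain ⟨Rr, r', hRr, hnr, hgr, her⟩ := hr _ hcr
      have hRcard : (Rl ∪ Rr).card = Rl.card + Rr.card :=
        Finset.card_union_of_disjoint (hdis.mono hRl hRr)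
      have hRsub : Rl ∪ Rr ⊆ cover next l (next v false) ∪ cover next r (next v true) :=
        Finset.union_subset_union hRl hRr
      have hgood : ∀ w ∈ Rl ∪ Rr, IsRichRoot next g (2 * s + 1) β w := fun w hw =>
        (Finset.mem_union.1 hw).elim (hgl w) (hgr w)
      have hdiff : s * ((cover next (node x l r) (some v) \
            cover next (node () l' r') (some v)).biUnion g).card + β * (l'.numNodes + r'.numNodes) ≤
          s * (2 * s + 1) * (Rl ∪ Rr).card + β * (l.numNodes + r.numNodes) := by
        have h := hsub (cover next (node x l r) (some v) \ cover next (node () l' r') (some v))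
          (cover next l (next v false) \ cover next l' (next v false))
          (cover next r (next v true) \ cover next r' (next v true)) (by
            intro w; simp; tauto)
        have h' := Nat.mul_le_mul_left s h
        rw [hRcard]
        nlinarith
      by_cases hN : (node () l' r').numNodes ≤ s
      · refine ⟨Rl ∪ Rr, node () l' r', hRsub.trans (Finset.subset_insert _ _), hN, hgood, ?_⟩
        simp only [numNodes]
        linarith
      · have hN2 : (node () l' r').numNodes ≤ 2 * s + 1 := by simp only [numNodes]; omega
        simp only [numNodes] at hN
        have hT1 : ((cover next (node () l' r') (some v)).biUnion g).card ≤ 2 * s + 1 :=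
          (hcard _).trans ((card_cover_le next _ _).trans hN2)
        have htot := Nat.mul_le_mul_left s (hsub (cover next (node x l r) (some v))
          (cover next (node x l r) (some v) \ cover next (node () l' r') (some v))
          (cover next (node () l' r') (some v)) (by intro w; simp; tauto))
        by_cases hrich : β ≤ ((cover next (node () l' r') (some v)).biUnion g).card
        · refine ⟨insert v (Rl ∪ Rr), nil, Finset.insert_subset_insert _ hRsub, by simp [numNodes],
            ?_, ?_⟩
          · intro w hw
            rcases Finset.mem_insert.1 hw with rfl | hw
            · exact ⟨_, hN2, hrich⟩
            · exact hgood w hw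
          · rw [Finset.card_insert_of_notMem fun h => hv (hRsub h)]
            simp only [cover_nil, Finset.sdiff_empty, numNodes]
            have := Nat.mul_le_mul_left s hT1
            nlinarith
        · refine ⟨Rl ∪ Rr, nil, hRsub.trans (Finset.subset_insert _ _), by simp [numNodes],
            hgood, ?_⟩
          simp only [cover_nil, Finset.sdiff_empty, numNodes]
          have h1 : s * ((cover next (node () l' r') (some v)).biUnion g).card ≤
              (l'.numNodes + r'.numNodes) * β := Nat.mul_le_mul (by omega) (by omega)
          nlinarith

end Cover

/-- In a data structure that explores at most `a t` cells to report `t` elements, many of the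
explored cells are roots of small trees that hold at least `β` of these elements. -/
theorem PointerMachine.Explorable.exists_richRoots {U : Type*} [DecidableEq U]
    {D : PointerMachine U} {W : Finset (Fin D.size)} (hW : D.Explorable W) {A : Finset U}
    (hA : ∀ x ∈ A, ∃ v ∈ W, D.cell v = some x) {a β : ℕ} (ha : 0 < a) (hβ : 0 < β)
    (hWA : W.card ≤ a * A.card) (ht : 8 * a * β ≤ A.card) :
    ∃ R : Finset (Fin D.size),
      (∀ v ∈ R, IsRichRoot D.next (fun v => (D.cell v).toFinset ∩ A) (4 * a * β + 1) β v) ∧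
      A.card ≤ 4 * (4 * a * β + 1) * R.card := by
  obtain ⟨T, hT1, hT2⟩ := hW.exists_cover_eq
  have hg : ∀ v, ((D.cell v).toFinset ∩ A).card ≤ 1 := fun v =>
    (Finset.card_le_card Finset.inter_subset_left).trans (by cases D.cell v <;> simp)
  -- With `s = 2 * a * β`, poor pieces lose at most `(β / s) * a * A.card`, half of `A`, and the
  -- remaining part `T'` loses at most `s`, a quarter of `A`. The last quarter must lie in rich
  -- pieces.
  obtain ⟨R, T', -, hT', hR, hcount⟩ := _root_.exists_richRoots D.next
    (fun v => (D.cell v).toFinset ∩ A) (s := 2 * a * β) (β := β) hg T (some D.root)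
    (by rw [hT2, hT1])
  refine ⟨R, fun v hv => ?_, ?_⟩
  · have := hR v hv
    rwa [show 2 * (2 * a * β) + 1 = 4 * a * β + 1 by ring] at this
  have h1 : A.card ≤ ((W \ T'.cover D.next (some D.root)).biUnion
      fun v => (D.cell v).toFinset ∩ A).card + 2 * a * β := by
    have hsub : A ⊆ ((W \ T'.cover D.next (some D.root)).biUnion
        fun v => (D.cell v).toFinset ∩ A) ∪ ((T'.cover D.next (some D.root)).biUnion
        fun v => (D.cell v).toFinset ∩ A) := by
      intro x hx
      obtain ⟨v, hv, hvx⟩ := hA x hx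
      simp only [Finset.mem_union, Finset.mem_biUnion, Finset.mem_sdiff, Finset.mem_inter,
        Option.mem_toFinset]
      by_cases hv' : v ∈ T'.cover D.next (some D.root)
      · exact Or.inr ⟨v, hv', hvx, hx⟩
      · exact Or.inl ⟨v, ⟨hv, hv'⟩, hvx, hx⟩
    have h2 := Finset.card_biUnion_le_card_mul (T'.cover D.next (some D.root))
      (fun v => (D.cell v).toFinset ∩ A) 1 fun v _ => hg v
    have h3 := T'.card_cover_le D.next (some D.root)
    have h4 := (Finset.card_le_card hsub).trans (Finset.card_union_le _ _)
    omega
  rw [hT2, hT1] at hcount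
  have h2 : 2 * a * β * A.card ≤ 2 * a * β * (2 * (2 * a * β) + 1) * R.card + a * β * A.card +
      2 * a * β * (2 * a * β) := by
    nlinarith [Nat.mul_le_mul_left (2 * a * β) h1, Nat.mul_le_mul_left β hWA]
  have h3 : a * β * (2 * A.card) ≤
      a * β * (2 * (2 * (2 * a * β) + 1) * R.card + A.card + 2 * (2 * a * β)) := by
    nlinarith
  have h4 := Nat.le_of_mul_le_mul_left h3 (Nat.mul_pos ha hβ)
  nlinarith

/-! ## A code in which few words agree on any given positions, and the hard instance -/

/-- The number of functions that take prescribed values on `P`. -/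
theorem card_functions_eqOn {X Y : Type*} [Fintype X] [Fintype Y] [DecidableEq X] [DecidableEq Y]
    (P : Finset X) (g : X → Y) :
    (Finset.univ.filter fun f : X → Y => ∀ x ∈ P, f x = g x).card =
      Fintype.card Y ^ (Fintype.card X - P.card) := by
  have h : (Finset.univ.filter fun f : X → Y => ∀ x ∈ P, f x = g x) =
      Fintype.piFinset fun x => if x ∈ P then {g x} else Finset.univ := by
    ext f
    simp only [Finset.mem_filter, Finset.mem_univ, true_and, Fintype.mem_piFinset]
    refine forall_congr' fun x => ?_
    by_cases hx : x ∈ P <;> simp [hx]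
  rw [h, Fintype.card_piFinset]
  have h' : ∀ x, (if x ∈ P then ({g x} : Finset Y) else Finset.univ).card =
      if x ∈ P then 1 else Fintype.card Y := fun x => by split_ifs <;> simp
  simp only [h', Finset.prod_ite, Finset.prod_const_one, one_mul, Finset.prod_const]
  congr 1
  rw [← Finset.compl_filter, Finset.card_compl]
  simp

/-- There are `m` words of length `t` over an alphabet of size `q` such that fewer than `r` of them
agree with given values at given `β` positions. -/
theorem exists_code {m t q β r : ℕ} (hq : 0 < q)
    (h : t ^ β * q ^ β * m ^ r < q ^ (β * r)) :
    ∃ f : Fin m → Fin t → Fin q, ∀ (B : Finset (Fin t)) (v : Fin t → Fin q), B.card = β →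
      (Finset.univ.filter fun i => ∀ b ∈ B, f i b = v b).card < r := by
  by_contra! hno
  -- `bad p` consists of the codes in which the words `p.2.2` take the values `p.2.1` at the
  -- positions `p.1`. Injectivity makes this a condition on exactly `β * r` letters, so each `bad p`
  -- is a fraction at most `q ^ (-β r)` of all codes, and by `h` there are too few triples to cover
  -- everything.
  let bad : (Fin β → Fin t) × (Fin β → Fin q) × (Fin r → Fin m) →
      Finset (Fin m × Fin t → Fin q) := fun p =>
    if Function.Injective p.1 ∧ Function.Injective p.2.2 then
      Finset.univ.filter fun f => ∀ k l, f (p.2.2 k, p.1 l) = p.2.1 l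
    else ∅
  have hbad : ∀ p, (bad p).card * q ^ (β * r) ≤ q ^ (m * t) := by
    intro p
    by_cases hp : Function.Injective p.1 ∧ Function.Injective p.2.2
    · have hinj : Function.Injective fun kl : Fin r × Fin β => (p.2.2 kl.1, p.1 kl.2) := by
        rintro ⟨k, l⟩ ⟨k', l'⟩ hkl
        simp only [Prod.mk.injEq] at hkl
        rw [hp.2 hkl.1, hp.1 hkl.2]
      let P := Finset.univ.image fun kl : Fin r × Fin β => (p.2.2 kl.1, p.1 kl.2)
      have hP : P.card = β * r := by
        rw [Finset.card_image_of_injective _ hinj]; simp [mul_comm]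
      have hPle : β * r ≤ m * t := by
        rw [← hP]; simpa using Finset.card_le_univ P
      rcases (bad p).eq_empty_or_nonempty with he | ⟨g, hg⟩
      · simp [he]
      · simp only [bad, if_pos hp, Finset.mem_filter, Finset.mem_univ, true_and] at hg
        have heq : bad p = Finset.univ.filter fun f => ∀ x ∈ P, f x = g x := by
          simp only [bad, if_pos hp]
          ext f
          simp only [Finset.mem_filter, Finset.mem_univ, true_and, P, Finset.mem_image]
          constructor
          · rintro hf _ ⟨⟨k, l⟩, rfl⟩
            rw [hf, hg]
          · intro hf k l
            rw [hf _ ⟨(k, l), rfl⟩, hg]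
        rw [heq, card_functions_eqOn, hP]
        simp only [Fintype.card_prod, Fintype.card_fin]
        rw [← pow_add, Nat.sub_add_cancel hPle]
    · simp [bad, if_neg hp]
  have hcover : (Finset.univ : Finset (Fin m × Fin t → Fin q)) ⊆ Finset.univ.biUnion bad := by
    intro f _
    obtain ⟨B, v, hB, hr⟩ := hno fun i b => f (i, b)
    obtain ⟨R, hR, hRr⟩ := Finset.exists_subset_card_eq hr
    simp only [Finset.mem_biUnion, Finset.mem_univ, true_and]
    refine ⟨(B.orderEmbOfFin hB, fun l => v (B.orderEmbOfFin hB l), R.orderEmbOfFin hRr), ?_⟩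
    simp only [bad]
    rw [if_pos ⟨(B.orderEmbOfFin hB).injective, (R.orderEmbOfFin hRr).injective⟩]
    simp only [Finset.mem_filter, Finset.mem_univ, true_and]
    intro k l
    exact (Finset.mem_filter.1 (hR (R.orderEmbOfFin_mem hRr k))).2 _ (B.orderEmbOfFin_mem hB l)
  have h1 := (Finset.card_le_card hcover).trans Finset.card_biUnion_le
  simp only [Finset.card_univ, Fintype.card_fun, Fintype.card_prod, Fintype.card_fin] at h1
  have h2 : q ^ (m * t) * q ^ (β * r) ≤ (t ^ β * q ^ β * m ^ r) * q ^ (m * t) := by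
    refine (Nat.mul_le_mul_right _ h1).trans ?_
    rw [Finset.sum_mul]
    refine (Finset.sum_le_sum fun p _ => hbad p).trans (le_of_eq ?_)
    simp [mul_assoc]
  rw [mul_comm] at h2
  exact absurd (Nat.le_of_mul_le_mul_right h2 (by positivity)) (by omega)

/-- A family of `m` row sets and `m` column sets, all of size `t q`, such that every row set has
`t` elements in common with every column set, and any `β` elements lie in at most `r ^ 2` of these
intersections. -/
theorem exists_hardInstance {m t q β r : ℕ} (hq : 0 < q)
    (h : t ^ β * q ^ β * m ^ r < q ^ (β * r)) :
    ∃ (u : ℕ) (A : Fin (m + m) → Finset (Fin u)), (∀ i, (A i).card = t * q) ∧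
      (∀ i j, (A (Fin.castAdd m i) ∩ A (Fin.natAdd m j)).card = t) ∧
      ∀ E : Finset (Fin u), E.card = β →
        (Finset.univ.filter fun p : Fin m × Fin m =>
          E ⊆ A (Fin.castAdd m p.1) ∩ A (Fin.natAdd m p.2)).card ≤ r ^ 2 := by
  obtain ⟨f, hf⟩ := exists_code hq h
  let e := Fintype.equivFin (Fin t × Fin q × Fin q)
  let row : Fin m → Finset (Fin t × Fin q × Fin q) := fun i =>
    Finset.univ.image fun z : Fin t × Fin q => (z.1, f i z.1, z.2)
  let col : Fin m → Finset (Fin t × Fin q × Fin q) := fun j =>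
    Finset.univ.image fun z : Fin t × Fin q => (z.1, z.2, f j z.1)
  have hrow : ∀ i x, x ∈ row i ↔ x.2.1 = f i x.1 := by
    rintro i ⟨b, x, y⟩
    simp only [row, Finset.mem_image, Finset.mem_univ, true_and, Prod.mk.injEq, Prod.exists]
    constructor
    · rintro ⟨_, _, rfl, rfl, rfl⟩; rfl
    · rintro rfl; exact ⟨b, y, rfl, rfl, rfl⟩
  have hcol : ∀ i x, x ∈ col i ↔ x.2.2 = f i x.1 := by
    rintro i ⟨b, x, y⟩
    simp only [col, Finset.mem_image, Finset.mem_univ, true_and, Prod.mk.injEq, Prod.exists]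
    constructor
    · rintro ⟨_, _, rfl, rfl, rfl⟩; rfl
    · rintro rfl; exact ⟨b, x, rfl, rfl, rfl⟩
  have hcap : ∀ i j, row i ∩ col j = Finset.univ.image fun b => (b, f i b, f j b) := by
    intro i j
    ext ⟨b, x, y⟩
    simp only [Finset.mem_inter, hrow, hcol, Finset.mem_image, Finset.mem_univ, true_and,
      Prod.mk.injEq]
    constructor
    · rintro ⟨rfl, rfl⟩; exact ⟨b, rfl, rfl, rfl⟩
    · rintro ⟨_, rfl, rfl, rfl⟩; exact ⟨rfl, rfl⟩
  refine ⟨_, Fin.append (fun i => (row i).map e.toEmbedding) fun j => (col j).map e.toEmbedding,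
    fun i => ?_, fun i j => ?_, fun E hE => ?_⟩
  · refine Fin.addCases (fun i => ?_) (fun i => ?_) i
    · rw [Fin.append_left, Finset.card_map, Finset.card_image_of_injective]
      · simp
      · rintro ⟨a, b⟩ ⟨a', b'⟩ hab
        simp only [Prod.mk.injEq] at hab
        rw [hab.1, hab.2.2]
    · rw [Fin.append_right, Finset.card_map, Finset.card_image_of_injective]
      · simp
      · rintro ⟨a, b⟩ ⟨a', b'⟩ hab
        simp only [Prod.mk.injEq] at hab
        rw [hab.1, hab.2.1]
  · rw [Fin.append_left, Fin.append_right, ← Finset.map_inter, Finset.card_map, hcap,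
      Finset.card_image_of_injective]
    · simp
    · intro a a' haa
      exact (Prod.mk.inj haa).1
  · simp only [Fin.append_left, Fin.append_right, ← Finset.map_inter]
    rcases (Finset.univ.filter fun p : Fin m × Fin m =>
      E ⊆ (row p.1 ∩ col p.2).map e.toEmbedding).eq_empty_or_nonempty with h0 | ⟨⟨i₀, j₀⟩, h0⟩
    · simp [h0]
    · obtain ⟨E', rfl⟩ : ∃ E' : Finset (Fin t × Fin q × Fin q), E = E'.map e.toEmbedding :=
        ⟨E.map e.symm.toEmbedding, by rw [Finset.map_map]; ext; simp⟩
      simp only [Finset.map_subset_map, Finset.mem_filter, Finset.mem_univ, true_and] at h0 ⊢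
      rw [Finset.card_map] at hE
      have hsub : ∀ i j, E' ⊆ row i ∩ col j →
          ∀ x ∈ E', x.2.1 = f i x.1 ∧ x.2.2 = f j x.1 := fun i j hs x hx =>
        ⟨(hrow _ _).1 (Finset.mem_inter.1 (hs hx)).1, (hcol _ _).1 (Finset.mem_inter.1 (hs hx)).2⟩
      -- One intersection has a single point per grid, so `E'` meets `β` different grids. Any other
      -- pair containing `E'` must then agree with `i₀` and `j₀` in these `β` letters.
      have hB : (E'.image Prod.fst).card = β := by
        rw [Finset.card_image_of_injOn, hE]
        intro x hx y hy hxy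
        have h1 := hsub _ _ h0 x hx
        have h2 := hsub _ _ h0 y hy
        have hxy' : x.1 = y.1 := hxy
        ext1
        · exact hxy'
        · ext1
          · rw [h1.1, h2.1, hxy']
          · rw [h1.2, h2.2, hxy']
      have hle := Nat.mul_le_mul (hf _ (f i₀) hB).le (hf _ (f j₀) hB).le
      rw [← Finset.card_product, ← sq] at hle
      refine (Finset.card_le_card ?_).trans hle
      rintro ⟨i, j⟩ hij
      simp only [Finset.mem_filter, Finset.mem_univ, true_and, Finset.mem_product,
        Finset.mem_image] at hij ⊢
      constructor
      · rintro _ ⟨x, hx, rfl⟩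
        rw [← (hsub _ _ hij x hx).1, ← (hsub _ _ h0 x hx).1]
      · rintro _ ⟨x, hx, rfl⟩
        rw [← (hsub _ _ hij x hx).2, ← (hsub _ _ h0 x hx).2]

/-! ## Families of sets of equal size as inputs of the two problems -/

/-- Singletons pad the total size up to exactly `n`. -/
theorem exists_setIntersection_input {u M d n : ℕ} (A : Fin M → Finset (Fin u)) (hM : 0 < M)
    (hd : 0 < d) (hA : ∀ i, (A i).card = d) (hn : M * d ≤ n) :
    ∃ (m : ℕ) (A' : Fin m → Finset (Fin u)) (f : Fin M → Fin m), ∑ i, (A' i).card = n ∧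
      ∀ i j, setIntersection A' (f i, f j) = A i ∩ A j := by
  obtain ⟨x, -⟩ : (A ⟨0, hM⟩).Nonempty := Finset.card_pos.1 (by rw [hA]; exact hd)
  refine ⟨M + (n - M * d), Fin.append A fun _ => {x}, Fin.castAdd _, ?_, ?_⟩
  · rw [Fin.sum_univ_add]
    simp [hA]
    omega
  · simp [setIntersection]

/-- The sets are written one after the other in blocks of length `d`, so each is the color set of an
interval; leftover positions receive an arbitrary color. -/
theorem exists_commonColors_input {u M d n : ℕ} (A : Fin M → Finset (Fin u)) (hM : 0 < M)
    (hd : 0 < d) (hA : ∀ i, (A i).card = d) (hn : M * d ≤ n) :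
    ∃ (a : Fin n → Fin u) (f : Fin M → Fin n × Fin n),
      ∀ i j, commonColors a (f i, f j) = A i ∩ A j := by
  obtain ⟨x, -⟩ : (A ⟨0, hM⟩).Nonempty := Finset.card_pos.1 (by rw [hA]; exact hd)
  let a : Fin n → Fin u := fun p =>
    if h : p.1 / d < M then (A ⟨p.1 / d, h⟩).orderEmbOfFin (hA _) ⟨p.1 % d, Nat.mod_lt _ hd⟩ else x
  have hlt : ∀ (i : Fin M) (k : ℕ), k < d → i.1 * d + k < n := fun i k hk => by
    have : (i.1 + 1) * d ≤ M * d := Nat.mul_le_mul_right d i.2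
    nlinarith
  let f : Fin M → Fin n × Fin n := fun i =>
    (⟨i.1 * d + 0, hlt i 0 hd⟩, ⟨i.1 * d + (d - 1), hlt i (d - 1) (by omega)⟩)
  have hval : ∀ (i : Fin M) (k : ℕ) (hk : k < d),
      a ⟨i.1 * d + k, hlt i k hk⟩ = (A i).orderEmbOfFin (hA i) ⟨k, hk⟩ := fun i k hk => by
    have h1 : (i.1 * d + k) / d = i.1 := by
      rw [mul_comm, Nat.mul_add_div hd, Nat.div_eq_of_lt hk, add_zero]
    have h2 : (i.1 * d + k) % d = k := by
      rw [mul_comm, Nat.mul_add_mod, Nat.mod_eq_of_lt hk]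
    simp only [a]
    rw [dif_pos (by rw [h1]; exact i.2)]
    simp only [h1, h2]
  have himage : ∀ i, (Finset.Icc (f i).1 (f i).2).image a = A i := by
    intro i
    ext y
    simp only [Finset.mem_image, Finset.mem_Icc]
    constructor
    · rintro ⟨p, ⟨h1, h2⟩, rfl⟩
      simp only [f, Fin.le_def] at h1 h2
      obtain ⟨k, hk⟩ := Nat.exists_eq_add_of_le (show i.1 * d ≤ p.1 by omega)
      have hp : p = ⟨i.1 * d + k, hlt i k (by omega)⟩ := Fin.ext hk
      rw [hp, hval i k (by omega)]
      exact Finset.orderEmbOfFin_mem _ _ _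
    · intro hy
      have : y ∈ Set.range ((A i).orderEmbOfFin (hA i)) := by
        rw [Finset.range_orderEmbOfFin]; exact hy
      obtain ⟨⟨k, hk⟩, rfl⟩ := this
      refine ⟨_, ⟨?_, ?_⟩, hval i k hk⟩
      · simp [f, Fin.le_def]
      · simp only [f, Fin.le_def]; omega
  exact ⟨a, f, fun i j => by simp only [commonColors, himage]⟩

/-! ### What a solution of either problem yields for a family of sets of equal size. -/

theorem exists_pointerMachine_of_reporting {n : ℕ} {s q α : ℝ}
    (h : SetIntersectionReporting n s q α ∨ CommonColorsReporting n s q α) {u M d : ℕ}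
    (A : Fin M → Finset (Fin u)) (hM : 0 < M) (hd : 0 < d) (hA : ∀ i, (A i).card = d)
    (hn : M * d ≤ n) :
    ∃ D : PointerMachine (Fin u), (D.size : ℝ) ≤ s ∧
      ∀ i j, D.Reports (A i ∩ A j) (q + α * ((A i ∩ A j).card : ℝ)) := by
  rcases h with h | h
  · obtain ⟨m, A', f, hsum, hf⟩ := exists_setIntersection_input A hM hd hA hn
    obtain ⟨D, hD, hq⟩ := h u m A' hsum
    exact ⟨D, hD, fun i j => by simpa only [hf] using hq (f i, f j)⟩
  · obtain ⟨a, f, hf⟩ := exists_commonColors_input A hM hd hA hn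
    obtain ⟨D, hD, hq⟩ := h u a
    exact ⟨D, hD, fun i j => by simpa only [hf] using hq (f i, f j)⟩

/-- Over a faithful semi-group, the supports of the sums picked for a query have the answer set as
their union. -/
theorem StorageScheme.Computes.exists_biUnion_eq {μ : CoeffMode} {G : Type*} [AddCommSemigroup G]
    (hG : Faithful μ G) {u : ℕ} {D : StorageScheme μ G (Fin u)} {A : Finset (Fin u)} {time : ℝ}
    (h : D.Computes A time) :
    ∃ T : Finset (Fin D.size), (T.card : ℝ) ≤ time ∧ T.biUnion D.supp = A := by
  obtain ⟨T, γ, hT, hγ, hpos, hsum⟩ := h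
  refine ⟨T, hT, ?_⟩
  -- The total coefficient of `w x` in the combination of picked sums: positive exactly where some
  -- picked support contains `x`, and constant in `w` in the fixed mode.
  let b : (Fin u → G) → Fin u → ℕ := fun w x =>
    ∑ i ∈ T, if x ∈ D.supp i then γ w i * D.coeff w i x else 0
  refine (hG u A (T.biUnion D.supp) (fun _ => 1) b (by simp) ?_ ?_ ?_).symm
  · cases μ with
    | fixed =>
      intro w w'
      have h1 : γ w = γ w' := hγ w w'
      have h2 : D.coeff w = D.coeff w' := D.coeff_admits w w'
      simp only [b, h1, h2]
    | weightDependent => trivial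
  · intro w x hx
    obtain ⟨i, hi, hxi⟩ := Finset.mem_biUnion.1 hx
    refine Finset.sum_pos' (fun _ _ => Nat.zero_le _) ⟨i, hi, ?_⟩
    rw [if_pos hxi]
    exact Nat.mul_pos (hpos w i hi) (D.coeff_pos w i x hxi)
  · intro w
    simp only [one_smul]
    rw [← hsum w]
    simp only [b, Finset.sum_smul]
    rw [Finset.sum_comm]
    refine Finset.sum_congr rfl fun i hi => ?_
    rw [StorageScheme.value, Finset.smul_sum]
    simp only [ite_smul, zero_smul, mul_smul]
    rw [← Finset.sum_filter]
    refine Finset.sum_congr ?_ fun _ _ => rfl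
    ext x
    simp only [Finset.mem_filter, Finset.mem_biUnion]
    exact ⟨fun hx => ⟨⟨i, hi, hx⟩, hx⟩, fun hx => hx.2⟩

theorem exists_supports_of_searching {μ : CoeffMode} {G : Type*} [AddCommSemigroup G]
    (hG : Faithful μ G) {n : ℕ} {s q : ℝ}
    (h : SetIntersectionSearching μ G n s q ∨ CommonColorsSearching μ G n s q) {u M d : ℕ}
    (A : Fin M → Finset (Fin u)) (hM : 0 < M) (hd : 0 < d) (hA : ∀ i, (A i).card = d)
    (hn : M * d ≤ n) :
    ∃ (k : ℕ) (supp : Fin k → Finset (Fin u)), (k : ℝ) ≤ s ∧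
      ∀ i j, ∃ T : Finset (Fin k), (T.card : ℝ) ≤ q ∧ T.biUnion supp = A i ∩ A j := by
  rcases h with h | h
  · obtain ⟨m, A', f, hsum, hf⟩ := exists_setIntersection_input A hM hd hA hn
    obtain ⟨D, hD, hq⟩ := h u m A' hsum
    exact ⟨D.size, D.supp, hD, fun i j => by
      simpa only [hf] using (hq (f i, f j)).exists_biUnion_eq hG⟩
  · obtain ⟨a, f, hf⟩ := exists_commonColors_input A hM hd hA hn
    obtain ⟨D, hD, hq⟩ := h u a
    exact ⟨D.size, D.supp, hD, fun i j => by
      simpa only [hf] using (hq (f i, f j)).exists_biUnion_eq hG⟩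

/-! ## The counting argument for reporting -/

/-- A vertex is a rich root for few queries if `β` elements are in few answer sets. -/
theorem PointerMachine.card_isRichRoot_le {u : ℕ} (D : PointerMachine (Fin u)) {P : Type*}
    [Fintype P] [DecidableEq P] (ans : P → Finset (Fin u)) {s β ρ : ℕ}
    (hans : ∀ E : Finset (Fin u), E.card = β → (Finset.univ.filter fun p => E ⊆ ans p).card ≤ ρ)
    (v : Fin D.size) (X : Finset P)
    (hX : ∀ p ∈ X, IsRichRoot D.next (fun v => (D.cell v).toFinset ∩ ans p) s β v) :
    X.card ≤ 4 ^ (s + 1) * (2 ^ s * ρ) := by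
  -- The elements met by a shape from `v` do not depend on the query. Each query in `X` therefore
  -- arises from a shape (at most `4 ^ (s + 1)`), a `β`-subset of its elements (at most `2 ^ s`),
  -- and one of at most `ρ` queries containing that subset.
  let el : BinaryTree Unit → Finset (Fin u) := fun T =>
    (T.cover D.next (some v)).biUnion fun v => (D.cell v).toFinset
  let shapes := (Finset.range (s + 1)).biUnion BinaryTree.treesOfNumNodesEq
  have hel : ∀ T ∈ shapes, (el T).card ≤ s := fun T hT => by
    have h1 : (el T).card ≤ (T.cover D.next (some v)).card * 1 :=
      Finset.card_biUnion_le_card_mul _ _ 1 fun v _ => by cases D.cell v <;> simp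
    obtain ⟨k, hk, hT⟩ := Finset.mem_biUnion.1 hT
    rw [BinaryTree.mem_treesOfNumNodesEq] at hT
    have h2 := T.card_cover_le D.next (some v)
    rw [Finset.mem_range] at hk
    omega
  have hsub : X ⊆ shapes.biUnion fun T => ((el T).powersetCard β).biUnion fun E =>
      Finset.univ.filter fun p => E ⊆ ans p := by
    intro p hp
    obtain ⟨T, hT, hβ⟩ := hX p hp
    have h1 : ((T.cover D.next (some v)).biUnion fun v => (D.cell v).toFinset ∩ ans p) =
        el T ∩ ans p := by
      rw [← Finset.biUnion_inter]
    rw [h1] at hβ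
    obtain ⟨E, hE, hEβ⟩ := Finset.exists_subset_card_eq hβ
    simp only [Finset.mem_biUnion, Finset.mem_powersetCard, Finset.mem_filter, Finset.mem_univ,
      true_and, shapes, Finset.mem_range, BinaryTree.mem_treesOfNumNodesEq]
    exact ⟨T, ⟨_, by omega, rfl⟩, E, ⟨hE.trans Finset.inter_subset_left, hEβ⟩,
      hE.trans Finset.inter_subset_right⟩
  refine (Finset.card_le_card hsub).trans ((Finset.card_biUnion_le_card_mul _ _ (2 ^ s * ρ)
    fun T hT => ?_).trans (Nat.mul_le_mul_right _ (BinaryTree.card_shapes_le _)))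
  refine (Finset.card_biUnion_le_card_mul _ _ ρ fun E hE =>
    hans E (Finset.mem_powersetCard.1 hE).2).trans (Nat.mul_le_mul_right _ ?_)
  rw [Finset.card_powersetCard]
  exact (Nat.choose_le_two_pow _ _).trans (Nat.pow_le_pow_right (by norm_num) (hel T hT))

/-- Double counting of the pairs of a query and a rich root for it: every query has many rich roots,
and every vertex is a rich root for few queries. -/
theorem PointerMachine.card_mul_le_size_mul {u : ℕ} (D : PointerMachine (Fin u)) {P : Type*}
    [Fintype P] [DecidableEq P] (ans : P → Finset (Fin u)) {a t β ρ : ℕ} (ha : 0 < a) (hβ : 0 < β)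
    (hans : ∀ E : Finset (Fin u), E.card = β → (Finset.univ.filter fun p => E ⊆ ans p).card ≤ ρ)
    (hcard : ∀ p, (ans p).card = t) (ht : 8 * a * β ≤ t)
    (hD : ∀ p, D.Reports (ans p) ((a * t : ℕ) : ℝ)) :
    Fintype.card P * t ≤ D.size * ρ * 2 ^ (16 * a * β + 8) := by
  classical
  have hR : ∀ p, ∃ R : Finset (Fin D.size),
      (∀ v ∈ R, IsRichRoot D.next (fun v => (D.cell v).toFinset ∩ ans p) (4 * a * β + 1) β v) ∧
      (ans p).card ≤ 4 * (4 * a * β + 1) * R.card := fun p => by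
    obtain ⟨W, hW, hA, htime⟩ := hD p
    exact hW.exists_richRoots hA ha hβ (by rw [hcard]; exact_mod_cast htime) (by rwa [hcard])
  choose R hR1 hR2 using hR
  have h1 : Fintype.card P * t ≤ 4 * (4 * a * β + 1) * ∑ p, (R p).card := by
    rw [Finset.mul_sum]
    refine le_trans (le_of_eq ?_) (Finset.sum_le_sum fun p _ => hR2 p)
    simp [hcard]
  have h2 : ∑ p, (R p).card = ∑ v, (Finset.univ.filter fun p => v ∈ R p).card := by
    simp only [Finset.card_filter]
    rw [Finset.sum_comm]
    simp
  have h3 : ∑ v, (Finset.univ.filter fun p => v ∈ R p).card ≤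
      D.size * (4 ^ (4 * a * β + 1 + 1) * (2 ^ (4 * a * β + 1) * ρ)) := by
    have := Finset.sum_le_card_nsmul (Finset.univ : Finset (Fin D.size))
      (fun v => (Finset.univ.filter fun p => v ∈ R p).card) _ fun v _ =>
        D.card_isRichRoot_le ans hans v _ fun p hp => hR1 p v (Finset.mem_filter.1 hp).2
    simpa using this
  have h4 : 4 * (4 * a * β + 1) ≤ 2 ^ (4 * a * β + 3) := by
    have := (Nat.lt_two_pow_self (n := 4 * a * β + 1)).le
    rw [show 4 * a * β + 3 = 4 * a * β + 1 + 2 by ring, pow_add _ _ 2]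
    omega
  rw [h2] at h1
  refine (h1.trans (Nat.mul_le_mul h4 h3)).trans (le_of_eq ?_)
  rw [show (4 : ℕ) = 2 ^ 2 by norm_num, ← pow_mul]
  ring

/-! ## Reporting -/

section Reporting

variable {n : ℕ} {s q α : ℝ}

/-- A query whose answer is a universe of `n` elements needs a separate cell for each of them. -/
theorem natCast_le_space_of_reporting (hn : 0 < n)
    (h : SetIntersectionReporting n s q α ∨ CommonColorsReporting n s q α) : (n : ℝ) ≤ s := by
  obtain ⟨D, hD, hq⟩ := exists_pointerMachine_of_reporting h
    (fun _ : Fin 1 => (Finset.univ : Finset (Fin n))) one_pos hn (by simp) (by simp)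
  obtain ⟨W, -, hW, -⟩ := hq 0 0
  choose v _ hv using fun x => hW x (by simp)
  have hinj : Function.Injective v := fun x y hxy => by
    have := (hv x).symm.trans (hxy ▸ hv y)
    exact Option.some_injective _ this
  have := Fintype.card_le_of_injective v hinj
  simp only [Fintype.card_fin] at this
  exact le_trans (by exact_mod_cast this) hD

/-- A query with empty answer still explores the root. -/
theorem one_le_overhead_of_reporting (hn : 2 ≤ n)
    (h : SetIntersectionReporting n s q α ∨ CommonColorsReporting n s q α) : 1 ≤ q := by
  obtain ⟨D, -, hq⟩ := exists_pointerMachine_of_reporting h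
    (fun i : Fin 2 => ({i} : Finset (Fin 2))) two_pos one_pos (by simp) (by simpa using hn)
  obtain ⟨W, hW, -, hcard⟩ := hq 0 1
  have h1 : (1 : ℝ) ≤ W.card := by exact_mod_cast Finset.card_pos.2 ⟨_, hW.1⟩
  have h2 : ({0} ∩ {1} : Finset (Fin 2)) = ∅ := by decide
  rw [h2] at hcard
  simp at hcard
  linarith

/-- The trade-off in terms of the parameters `h` and `k` of the hard instance. -/
theorem reporting_tradeoff {a k h : ℕ} {c : ℕ} (ha : 1 + α ≤ a) (ha0 : 0 < a)
    (hk : 0 < k) (hhk : h ≤ k ^ 2) (hkh : 2 * k < h) (hc : q ≤ c) (hc0 : 0 < c) (hn1 : 1 < n)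
    (hn : 2 ^ h * (2 ^ (k + 5) * (a * k * c)) ≤ n)
    (hyp : SetIntersectionReporting n s q α ∨ CommonColorsReporting n s q α) :
    (2 : ℝ) ^ h * 2 ^ h * (16 * a * k * c) ≤
      s * (Nat.clog 2 n : ℝ) ^ 2 * 2 ^ (32 * a * k + 8) := by
  -- The instance has `β = 2 * k`, alphabet size `2 ^ k` and `2 ^ h` words. The choice `t = 8 * a *
  -- β * c` gives both `8 * a * β ≤ t` and `q ≤ t`, so that the query time `q + α * t` is at most `a
  -- * t`.
  set t := 16 * a * k * c with ht
  set r := Nat.clog 2 n with hr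
  have ht0 : 0 < t := by positivity
  have hr0 : 0 < r := Nat.clog_pos (by norm_num) hn1
  have hsize : (2 ^ h + 2 ^ h) * (t * 2 ^ k) ≤ n := by
    refine le_trans (le_of_eq ?_) hn
    rw [ht]; ring
  have htq : t * 2 ^ k ≤ 2 ^ r := by
    refine le_trans ?_ (Nat.le_pow_clog (by norm_num) n)
    refine le_trans ?_ hsize
    exact Nat.le_mul_of_pos_left _ (by positivity)
  -- In exponents of 2: the first two factors contribute at most `2 * k * r < h * r`, the third `h *
  -- r`, and `2 * h * r ≤ 2 * k ^ 2 * r` is the exponent on the right.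
  have hcode : t ^ (2 * k) * (2 ^ k) ^ (2 * k) * (2 ^ h) ^ r < (2 ^ k) ^ (2 * k * r) := by
    have h1 : t ^ (2 * k) * (2 ^ k) ^ (2 * k) ≤ 2 ^ (r * (2 * k)) := by
      rw [← mul_pow, pow_mul 2 r]
      exact Nat.pow_le_pow_left htq _
    have h2 : 2 ^ (r * (2 * k)) < 2 ^ (h * r) := by
      refine Nat.pow_lt_pow_right (by norm_num) ?_
      rw [mul_comm]
      exact Nat.mul_lt_mul_of_pos_right hkh hr0
    calc t ^ (2 * k) * (2 ^ k) ^ (2 * k) * (2 ^ h) ^ r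
        ≤ 2 ^ (r * (2 * k)) * (2 ^ h) ^ r := Nat.mul_le_mul_right _ h1
      _ < 2 ^ (h * r) * (2 ^ h) ^ r := Nat.mul_lt_mul_of_pos_right h2 (by positivity)
      _ = 2 ^ (2 * h * r) := by rw [← pow_mul, ← pow_add]; congr 1; ring
      _ ≤ 2 ^ (2 * k ^ 2 * r) := Nat.pow_le_pow_right (by norm_num) (by gcongr)
      _ = (2 ^ k) ^ (2 * k * r) := by rw [← pow_mul]; congr 1; ring
  obtain ⟨u, A, hA, hAt, hE⟩ := exists_hardInstance (by positivity) hcode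
  obtain ⟨D, hD, hq⟩ := exists_pointerMachine_of_reporting hyp A (by positivity) (by positivity)
    hA hsize
  have hqt : q ≤ t := by
    refine hc.trans ?_
    rw [ht]
    exact_mod_cast Nat.le_mul_of_pos_left c (by positivity)
  have hmain := D.card_mul_le_size_mul
    (fun p : Fin (2 ^ h) × Fin (2 ^ h) => A (Fin.castAdd _ p.1) ∩ A (Fin.natAdd _ p.2))
    (a := a) (t := t) ha0 (by positivity) hE (fun p => hAt _ _)
    (by rw [ht]; nlinarith [Nat.mul_pos ha0 hk, Nat.mul_le_mul_left (16 * a * k) hc0]) fun p => by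
      obtain ⟨W, h1, h2, h3⟩ := hq (Fin.castAdd _ p.1) (Fin.natAdd _ p.2)
      refine ⟨W, h1, h2, h3.trans ?_⟩
      rw [hAt]
      push_cast
      have : (0 : ℝ) ≤ t := by positivity
      nlinarith
  simp only [Fintype.card_prod, Fintype.card_fin] at hmain
  have hmain' : (2 : ℝ) ^ h * 2 ^ h * t ≤ D.size * (r : ℝ) ^ 2 * 2 ^ (16 * a * (2 * k) + 8) := by
    exact_mod_cast hmain
  rw [ht] at hmain'
  push_cast at hmain'
  rw [show 16 * a * (2 * k) + 8 = 32 * a * k + 8 by ring] at hmain'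
  refine hmain'.trans ?_
  gcongr

end Reporting

/-! ### Rounding estimates, and the choice of parameters for reporting. -/

theorem Nat.clog_two_le_two_mul_logb {n : ℕ} (hn : 2 ≤ n) :
    (Nat.clog 2 n : ℝ) ≤ 2 * Real.logb 2 n := by
  have h1 : Nat.clog 2 n ≤ Nat.log 2 n + 1 := by
    rw [Nat.clog_le_iff_le_pow (by norm_num)]
    exact (Nat.lt_pow_succ_log_self (by norm_num) n).le
  have h2 : (Nat.log 2 n : ℝ) ≤ Real.logb 2 n := Real.natLog_le_logb n 2
  have h3 : (1 : ℝ) ≤ Nat.log 2 n := by exact_mod_cast Nat.log_pos (by norm_num) hn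
  have h4 : (Nat.clog 2 n : ℝ) ≤ Nat.log 2 n + 1 := by exact_mod_cast h1
  linarith

theorem one_le_logb_two_natCast {n : ℕ} (hn : 2 ≤ n) : 1 ≤ Real.logb 2 (n : ℝ) := by
  rw [Real.le_logb_iff_rpow_le (by norm_num) (by positivity), Real.rpow_one]
  exact_mod_cast hn

theorem natCeil_le_two_mul {q : ℝ} (hq : 1 ≤ q) : (⌈q⌉₊ : ℝ) ≤ 2 * q := by
  have := Nat.ceil_lt_add_one (zero_le_one.trans hq)
  linarith

theorem natCast_le_two_pow (k : ℕ) : (k : ℝ) ≤ 2 ^ k := by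
  exact_mod_cast (Nat.lt_two_pow_self (n := k)).le

/-- The lower bound for reporting when `k = ⌈√(log (n / q))⌉` is large. -/
theorem sq_le_of_reporting {n : ℕ} {s q α : ℝ} {a j : ℕ} (ha : 1 + α ≤ a) (ha0 : 0 < a)
    (hj : a + 10 ≤ j) (hn2 : 2 ≤ n) (hq : 1 ≤ q) (hlow : q * 2 ^ j ^ 2 ≤ n)
    (hupp : n ≤ q * 2 ^ (j + 1) ^ 2)
    (hyp : SetIntersectionReporting n s q α ∨ CommonColorsReporting n s q α) :
    (n : ℝ) ^ 2 ≤
      s * q * Real.logb 2 n ^ 2 * 2 ^ ((32 * a + 3) * (j + 1) + (a + 19)) := by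
  set k := j + 1 with hk
  set c := ⌈q⌉₊ with hc
  have hq0 : 0 < q := by linarith
  have hc0 : 0 < c := Nat.ceil_pos.2 hq0
  have hqc : q ≤ c := Nat.le_ceil q
  have hcq : (c : ℝ) ≤ 2 * q := natCeil_le_two_mul hq
  set m := 2 ^ (k + 5) * (a * k * c) with hm
  have hm0 : 0 < m := by positivity
  have hak : (a : ℝ) * k ≤ 2 ^ (a + k) := by
    rw [pow_add]
    exact mul_le_mul (natCast_le_two_pow a) (natCast_le_two_pow k) (by positivity) (by positivity)
  have hmq : (m : ℝ) ≤ q * 2 ^ (2 * k + 6 + a) := by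
    rw [hm]
    push_cast
    calc (2 : ℝ) ^ (k + 5) * (a * k * c) ≤ 2 ^ (k + 5) * (2 ^ (a + k) * (2 * q)) := by gcongr
      _ = q * 2 ^ (2 * k + 6 + a) := by ring
  -- The reserve `2 * k + 2` is what later forces `2 * k < h`.
  have hjk : 2 * k + 6 + a + (2 * k + 2) ≤ j ^ 2 := by
    obtain ⟨e, he⟩ := Nat.exists_eq_add_of_le hj
    rw [hk, he]
    nlinarith [Nat.zero_le (a * e), Nat.zero_le (e * e), Nat.zero_le (a * a)]
  have hmn : m ≤ n := by
    have : (m : ℝ) ≤ n := hmq.trans (le_trans (by gcongr; norm_num; omega) hlow)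
    exact_mod_cast this
  -- The largest `h` for which the instance, of total size `2 ^ h * m`, fits into `n`.
  set h := Nat.log 2 (n / m) with hh
  have h1 : 2 ^ h * m ≤ n := by
    rw [← Nat.le_div_iff_mul_le hm0]
    exact Nat.pow_log_le_self 2 (Nat.div_pos hmn hm0).ne'
  have h2 : n < 2 ^ (h + 1) * m := by
    rw [← Nat.div_lt_iff_lt_mul hm0]
    exact Nat.lt_pow_succ_log_self (by norm_num) _
  have h1' : (2 : ℝ) ^ h * m ≤ n := by exact_mod_cast h1
  have h2' : (n : ℝ) ≤ 2 ^ (h + 1) * m := by exact_mod_cast h2.le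
  have hqm : q ≤ m := by
    refine hqc.trans ?_
    rw [hm, ← mul_assoc]
    exact_mod_cast Nat.le_mul_of_pos_left c (by positivity)
  have hhk : h ≤ k ^ 2 := by
    have h3 : q * 2 ^ h ≤ q * 2 ^ k ^ 2 := by
      refine le_trans ?_ (h1'.trans hupp)
      rw [mul_comm]; gcongr
    have h4 := le_of_mul_le_mul_left h3 hq0
    exact (pow_le_pow_iff_right₀ (by norm_num)).1 h4
  have hkh : 2 * k < h := by
    have h3 : q * 2 ^ j ^ 2 ≤ q * 2 ^ (h + 1 + (2 * k + 6 + a)) := by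
      refine hlow.trans (h2'.trans ?_)
      calc (2 : ℝ) ^ (h + 1) * m ≤ 2 ^ (h + 1) * (q * 2 ^ (2 * k + 6 + a)) := by gcongr
        _ = q * 2 ^ (h + 1 + (2 * k + 6 + a)) := by ring
    have h4 := (pow_le_pow_iff_right₀ (by norm_num)).1 (le_of_mul_le_mul_left h3 hq0)
    omega
  have htr := reporting_tradeoff ha ha0 (by omega) hhk hkh hqc hc0 hn2 h1 hyp
  have hr := Nat.clog_two_le_two_mul_logb hn2
  have hs : 0 ≤ s := le_trans (Nat.cast_nonneg n)
    (natCast_le_space_of_reporting (by omega) hyp)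
  -- The square splits into the left side of the trade-off and a rest of order `q * 2 ^ O(k)`. The
  -- exponent `32 * a + 3` collects `32 * a` from the trees, 2 from the alphabet and 1 from bounding
  -- the factor `k` by `2 ^ k`.
  calc (n : ℝ) ^ 2 ≤ (2 ^ (h + 1) * m) ^ 2 := by gcongr
    _ = ((2 : ℝ) ^ h * 2 ^ h * (16 * a * k * c)) * (2 ^ (2 * k + 8) * (a * k) * c) := by
      rw [hm]; push_cast; ring
    _ ≤ (s * (Nat.clog 2 n : ℝ) ^ 2 * 2 ^ (32 * a * k + 8)) *
        (2 ^ (2 * k + 8) * 2 ^ (a + k) * (2 * q)) := by gcongr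
    _ ≤ (s * (2 * Real.logb 2 n) ^ 2 * 2 ^ (32 * a * k + 8)) *
        (2 ^ (2 * k + 8) * 2 ^ (a + k) * (2 * q)) := by gcongr
    _ = s * q * Real.logb 2 n ^ 2 * 2 ^ ((32 * a + 3) * k + (a + 19)) := by ring

theorem reporting_lower_bound {n : ℕ} {s q α : ℝ} {a : ℕ} (ha : 1 + α ≤ a) (ha0 : 0 < a)
    (hn : 2 ≤ n)
    (hyp : SetIntersectionReporting n s q α ∨ CommonColorsReporting n s q α) :
    (1 / 2 ^ ((a + 11) ^ 2 + 33 * a + 22) : ℝ) * ((n : ℝ) ^ 2 /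
      ((2 : ℝ) ^ ((32 * a + 3 : ℝ) * √(Real.logb 2 ((n : ℝ) / q))) * Real.logb 2 (n : ℝ) ^ 2))
        ≤ s * q := by
  have hs := natCast_le_space_of_reporting (by omega) hyp
  have hq := one_le_overhead_of_reporting hn hyp
  have hq0 : 0 < q := by linarith
  have hn0 : (0 : ℝ) < n := by positivity
  set L := Real.logb 2 ((n : ℝ) / q) with hL
  have hpowL : q * (2 : ℝ) ^ L = n := by
    rw [hL, Real.rpow_logb (by norm_num) (by norm_num) (by positivity)]
    field_simp
  set X := (2 : ℝ) ^ ((32 * a + 3 : ℝ) * √L) with hX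
  have hX1 : 1 ≤ X := Real.one_le_rpow (by norm_num) (by positivity)
  have hl := one_le_logb_two_natCast hn
  have hsq : 0 ≤ s * q := mul_nonneg (hn0.le.trans hs) hq0.le
  rw [one_div_mul_eq_div, div_div, div_le_iff₀ (by positivity)]
  -- For bounded `L`, `q` is at least a constant times `n`, and the trivial bound `n ≤ s` suffices.
  -- This case includes `L < 0`, where `√L = 0`.
  by_cases hLa : L ≤ ((a + 11 : ℕ) : ℝ) ^ 2
  · have h1 : (n : ℝ) ≤ q * 2 ^ (a + 11) ^ 2 := by
      rw [← hpowL, ← Real.rpow_natCast 2 ((a + 11) ^ 2)]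
      gcongr
      · norm_num
      · exact_mod_cast hLa
    calc (n : ℝ) ^ 2 = n * n := sq _
      _ ≤ s * (q * 2 ^ (a + 11) ^ 2) := mul_le_mul hs h1 hn0.le (hn0.le.trans hs)
      _ = s * q * ((1 * 1) * 2 ^ (a + 11) ^ 2) := by ring
      _ ≤ s * q * ((X * Real.logb 2 n ^ 2) * 2 ^ ((a + 11) ^ 2 + 33 * a + 22)) := by
        gcongr
        · exact one_le_pow₀ hl
        · norm_num
        · omega
  · push Not at hLa
    have hL0 : 0 < L := lt_of_le_of_lt (by positivity) hLa
    have hsqrt : ((a + 11 : ℕ) : ℝ) < √L := Real.lt_sqrt_of_sq_lt hLa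
    obtain ⟨j, hj⟩ : ∃ j, ⌈√L⌉₊ = j + 1 :=
      Nat.exists_eq_succ_of_ne_zero (Nat.ceil_pos.2 (Real.sqrt_pos.2 hL0)).ne'
    have hj1 : √L ≤ j + 1 := by
      have := Nat.le_ceil √L
      rw [hj] at this
      exact_mod_cast this
    have hj2 : (j : ℝ) ≤ √L := by
      have := Nat.ceil_lt_add_one (Real.sqrt_nonneg L)
      rw [hj] at this
      push_cast at this
      linarith
    have hja : a + 10 ≤ j := by
      have : ((a + 11 : ℕ) : ℝ) < ((j + 1 : ℕ) : ℝ) := by push_cast at hsqrt ⊢; linarith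
      have := Nat.cast_lt.1 this
      omega
    have hlow : q * 2 ^ j ^ 2 ≤ n := by
      rw [← hpowL, ← Real.rpow_natCast 2 (j ^ 2)]
      gcongr
      · norm_num
      · push_cast
        exact (Real.le_sqrt' (by have : 0 < j := by omega
                                 positivity)).1 hj2
    have hupp : n ≤ q * 2 ^ (j + 1) ^ 2 := by
      rw [← hpowL, ← Real.rpow_natCast 2 ((j + 1) ^ 2)]
      gcongr
      · norm_num
      · push_cast
        exact (Real.sqrt_le_left (by positivity)).1 hj1
    have hmain := sq_le_of_reporting ha ha0 hja hn hq hlow hupp hyp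
    have hpow : (2 : ℝ) ^ ((32 * a + 3) * (j + 1)) ≤ X * 2 ^ (32 * a + 3) := by
      rw [mul_add, mul_one, pow_add]
      gcongr
      rw [hX, ← Real.rpow_natCast]
      gcongr
      · norm_num
      · push_cast
        gcongr
    calc (n : ℝ) ^ 2
        ≤ s * q * Real.logb 2 n ^ 2 * 2 ^ ((32 * a + 3) * (j + 1) + (a + 19)) := hmain
      _ = s * q * (Real.logb 2 n ^ 2 * (2 ^ ((32 * a + 3) * (j + 1)) * 2 ^ (a + 19))) := by ring
      _ ≤ s * q * (Real.logb 2 n ^ 2 * (X * 2 ^ (32 * a + 3) * 2 ^ (a + 19))) := by gcongr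
      _ = s * q * (X * Real.logb 2 n ^ 2 * 2 ^ (33 * a + 22)) := by ring
      _ ≤ s * q * (X * Real.logb 2 n ^ 2 * 2 ^ ((a + 11) ^ 2 + 33 * a + 22)) := by
        gcongr
        · norm_num
        · omega

/-! ## Searching -/

section Searching

variable {μ : CoeffMode} {G : Type*} [AddCommSemigroup G] {n : ℕ} {s q : ℝ}

/-- A nonempty answer set cannot be the union of no supports. -/
theorem one_le_of_searching (hG : Faithful μ G) (hn : 0 < n)
    (h : SetIntersectionSearching μ G n s q ∨ CommonColorsSearching μ G n s q) :
    1 ≤ s ∧ 1 ≤ q := by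
  obtain ⟨k, supp, hk, hq⟩ := exists_supports_of_searching hG h
    (fun _ : Fin 1 => (Finset.univ : Finset (Fin n))) one_pos hn (by simp) (by simp)
  obtain ⟨T, hT, hTA⟩ := hq 0 0
  have hx : (⟨0, hn⟩ : Fin n) ∈ T.biUnion supp := by rw [hTA]; simp
  obtain ⟨i, hi, -⟩ := Finset.mem_biUnion.1 hx
  have h1 : (1 : ℝ) ≤ T.card := by exact_mod_cast Finset.card_pos.2 ⟨i, hi⟩
  have h2 : (1 : ℝ) ≤ k := by exact_mod_cast (Nat.zero_le i.1).trans_lt i.2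
  exact ⟨h2.trans hk, h1.trans hT⟩

/-- The trade-off in terms of the parameter `h` of the hard instance. -/
theorem searching_tradeoff (hG : Faithful μ G) {h c : ℕ} (hh : 0 < h) (hc : q ≤ c) (hc0 : 0 < c)
    (hn : 2 ^ h * (8 * h * c) ≤ n)
    (hyp : SetIntersectionSearching μ G n s q ∨ CommonColorsSearching μ G n s q) :
    (2 : ℝ) ^ h * 2 ^ h ≤ s * (2 * (Nat.clog 2 n : ℝ) + 1) ^ 2 := by
  -- Here `β = 2 * h`, the alphabet is binary and `r = 2 * l + 1`. With `t = β * c`, covering an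
  -- answer by at most `c` supports forces one of size at least `β`. In `hcode` the exponent `4 * h
  -- * l + h` stays below `4 * h * l + 2 * h`.
  set t := 2 * h * c with ht
  set l := Nat.clog 2 n with hl
  have hsize : (2 ^ h + 2 ^ h) * (t * 2) ≤ n := by
    refine le_trans (le_of_eq ?_) hn
    rw [ht]; ring
  have ht2 : t * 2 ≤ 2 ^ l :=
    (Nat.le_mul_of_pos_left _ (by positivity)).trans
      (hsize.trans (Nat.le_pow_clog (by norm_num) n))
  have hcode : t ^ (2 * h) * 2 ^ (2 * h) * (2 ^ h) ^ (2 * l + 1) < 2 ^ (2 * h * (2 * l + 1)) := by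
    calc t ^ (2 * h) * 2 ^ (2 * h) * (2 ^ h) ^ (2 * l + 1)
        ≤ (2 ^ l) ^ (2 * h) * (2 ^ h) ^ (2 * l + 1) := by
          rw [← mul_pow]
          exact Nat.mul_le_mul_right _ (Nat.pow_le_pow_left ht2 _)
      _ = 2 ^ (4 * h * l + h) := by rw [← pow_mul, ← pow_mul, ← pow_add]; congr 1; ring
      _ < 2 ^ (2 * h * (2 * l + 1)) := Nat.pow_lt_pow_right (by norm_num) (by nlinarith)
  obtain ⟨u, A, hA, hAt, hE⟩ := exists_hardInstance (by norm_num) hcode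
  obtain ⟨k, supp, hk, hq⟩ := exists_supports_of_searching hG hyp A (by positivity)
    (by positivity) hA hsize
  have hpick : ∀ p : Fin (2 ^ h) × Fin (2 ^ h), ∃ i, 2 * h ≤ (supp i).card ∧
      supp i ⊆ A (Fin.castAdd _ p.1) ∩ A (Fin.natAdd _ p.2) := by
    intro p
    obtain ⟨T, hT, hTA⟩ := hq (Fin.castAdd _ p.1) (Fin.natAdd _ p.2)
    have hTc : T.card ≤ c := by exact_mod_cast hT.trans hc
    by_contra! hno
    have hsmall : ∀ i ∈ T, (supp i).card ≤ 2 * h - 1 := fun i hi => by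
      by_contra hlt
      refine hno i (by omega) ?_
      rw [← hTA]
      exact Finset.subset_biUnion_of_mem supp hi
    have h1 := Finset.card_biUnion_le_card_mul T supp _ hsmall
    rw [hTA, hAt] at h1
    have h2 : t ≤ c * (2 * h - 1) := h1.trans (Nat.mul_le_mul_right _ hTc)
    have h3 : c * (2 * h - 1) < c * (2 * h) := Nat.mul_lt_mul_of_pos_left (by omega) hc0
    rw [ht, mul_comm (2 * h)] at h2
    omega
  choose f hf1 hf2 using hpick
  -- All queries assigned to one stored sum contain the same `β` elements, so there are at most `r ^
  -- 2` of them.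
  have hfib : ∀ i ∈ Finset.univ.image f,
      (Finset.univ.filter fun p => f p = i).card ≤ (2 * l + 1) ^ 2 := by
    intro i hi
    obtain ⟨p, -, rfl⟩ := Finset.mem_image.1 hi
    obtain ⟨E, hEs, hEc⟩ := Finset.exists_subset_card_eq (hf1 p)
    refine (Finset.card_le_card ?_).trans (hE E hEc)
    intro p' hp'
    simp only [Finset.mem_filter, Finset.mem_univ, true_and] at hp' ⊢
    exact hEs.trans (hp' ▸ hf2 p')
  have h1 := Finset.card_le_mul_card_image Finset.univ _ hfib
  have h2 : (Finset.univ.image f).card ≤ k := by simpa using Finset.card_le_univ (Finset.univ.image f)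
  have h3 : 2 ^ h * 2 ^ h ≤ (2 * l + 1) ^ 2 * k := by
    simpa using h1.trans (Nat.mul_le_mul_left _ h2)
  calc (2 : ℝ) ^ h * 2 ^ h ≤ (2 * (l : ℝ) + 1) ^ 2 * k := by exact_mod_cast h3
    _ = k * (2 * (l : ℝ) + 1) ^ 2 := mul_comm _ _
    _ ≤ s * (2 * (l : ℝ) + 1) ^ 2 := by gcongr

/-- For the largest `h` that fits, `n` is at most of order `2 ^ h * h * q`, and the trade-off bounds
`4 ^ h` by `s` times order `log² n`. The factor `h ^ 2` supplies the other `log² n`. If not even `h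
= 1` fits, `q` is at least `n / 32`. -/
theorem searching_lower_bound (hG : Faithful μ G) (hn : 2 ≤ n)
    (hyp : SetIntersectionSearching μ G n s q ∨ CommonColorsSearching μ G n s q) :
    (1 / 2 ^ 20 : ℝ) * ((n : ℝ) ^ 2 / Real.logb 2 (n : ℝ) ^ 4) ≤ s * q ^ 2 := by
  obtain ⟨hs, hq⟩ := one_le_of_searching hG (by omega) hyp
  have hl := one_le_logb_two_natCast hn
  have hq0 : 0 < q := by linarith
  set c := ⌈q⌉₊ with hc
  have hc0 : 0 < c := Nat.ceil_pos.2 hq0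
  have hqc : q ≤ c := Nat.le_ceil q
  have hcq : (c : ℝ) ≤ 2 * q := natCeil_le_two_mul hq
  rw [one_div_mul_eq_div, div_div, div_le_iff₀ (by positivity)]
  by_cases hcn : 2 ^ 1 * (8 * 1 * c) ≤ n
  · set h := Nat.findGreatest (fun h => 2 ^ h * (8 * h * c) ≤ n) n with hh
    have hspec : 2 ^ h * (8 * h * c) ≤ n :=
      Nat.findGreatest_spec (P := fun h => 2 ^ h * (8 * h * c) ≤ n) (by omega) hcn
    have h0 : 0 < h := Nat.le_findGreatest (by omega) hcn
    have h2n : 2 ^ h ≤ n := (Nat.le_mul_of_pos_right _ (by positivity)).trans hspec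
    -- The search bound `n` in `Nat.findGreatest` is not attained, so `h + 1` is still in range and
    -- fails the predicate.
    have hlt : h < n := Nat.lt_two_pow_self.trans_le h2n
    have hgr : n < 2 ^ (h + 1) * (8 * (h + 1) * c) := by
      by_contra! hle
      exact Nat.findGreatest_is_greatest (Nat.lt_succ_self h) hlt hle
    have hgr' : (n : ℝ) ≤ 2 ^ h * (64 * h * q) := by
      have h1 : (n : ℝ) ≤ 2 ^ (h + 1) * (8 * (h + 1) * c) := by exact_mod_cast hgr.le
      have h2 : (1 : ℝ) ≤ h := by exact_mod_cast h0
      calc (n : ℝ) ≤ 2 ^ (h + 1) * (8 * (h + 1) * c) := h1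
        _ ≤ 2 ^ (h + 1) * (8 * (h + h) * (2 * q)) := by gcongr
        _ = 2 ^ h * (64 * h * q) := by ring
    have hhl : (h : ℝ) ≤ 2 * Real.logb 2 n := by
      refine le_trans ?_ (Nat.clog_two_le_two_mul_logb hn)
      exact_mod_cast (Nat.pow_le_pow_iff_right (by norm_num)).1
        (h2n.trans (Nat.le_pow_clog (by norm_num) n))
    have hr : 2 * (Nat.clog 2 n : ℝ) + 1 ≤ 5 * Real.logb 2 n := by
      linarith [Nat.clog_two_le_two_mul_logb hn]
    calc (n : ℝ) ^ 2 ≤ (2 ^ h * (64 * h * q)) ^ 2 := by gcongr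
      _ = (2 ^ h * 2 ^ h) * (64 * h * q) ^ 2 := by ring
      _ ≤ (s * (2 * (Nat.clog 2 n : ℝ) + 1) ^ 2) * (64 * h * q) ^ 2 := by
        exact mul_le_mul_of_nonneg_right (searching_tradeoff hG h0 hqc hc0 hspec hyp) (sq_nonneg _)
      _ ≤ (s * (5 * Real.logb 2 n) ^ 2) * (64 * (2 * Real.logb 2 n) * q) ^ 2 := by gcongr
      _ = s * q ^ 2 * (Real.logb 2 n ^ 4 * 409600) := by ring
      _ ≤ s * q ^ 2 * (Real.logb 2 n ^ 4 * 2 ^ 20) := by gcongr; norm_num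
  · have hnq : (n : ℝ) ≤ 32 * q := by
      have : (n : ℝ) ≤ 16 * c := by exact_mod_cast (show n ≤ 16 * c by omega)
      linarith
    calc (n : ℝ) ^ 2 ≤ (32 * q) ^ 2 := by gcongr
      _ = 1 * q ^ 2 * (1 * 1024) := by ring
      _ ≤ s * q ^ 2 * (Real.logb 2 n ^ 4 * 2 ^ 20) := by
        gcongr
        · exact one_le_pow₀ hl
        · norm_num

end Searching

theorem mainTheorem8 :
    -- reporting, pointer machine model, query time `Q n + α t`
    (∀ α : ℝ, 0 ≤ α → ∃ c : ℝ, 0 < c ∧ ∃ C : ℝ, 0 < C ∧ ∃ N : ℕ, ∀ S Q : ℕ → ℝ,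
      ((∀ n, SetIntersectionReporting n (S n) (Q n) α) ∨
        (∀ n, CommonColorsReporting n (S n) (Q n) α)) →
      ∀ n : ℕ, N ≤ n →
        c * ((n : ℝ) ^ 2 /
          ((2 : ℝ) ^ (C * √(Real.logb 2 ((n : ℝ) / Q n))) * Real.logb 2 (n : ℝ) ^ 2))
            ≤ S n * Q n) ∧
    -- searching, semi-group model
    (∃ c : ℝ, 0 < c ∧ ∃ N : ℕ, ∀ (μ : CoeffMode) (G : Type*) [AddCommSemigroup G], Faithful μ G →
      ∀ S Q : ℕ → ℝ,
      ((∀ n, SetIntersectionSearching μ G n (S n) (Q n)) ∨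
        (∀ n, CommonColorsSearching μ G n (S n) (Q n))) →
      ∀ n : ℕ, N ≤ n →
        c * ((n : ℝ) ^ 2 / Real.logb 2 (n : ℝ) ^ 4) ≤ S n * Q n ^ 2) := by
  constructor
  · intro α hα
    have ha : 1 + α ≤ ⌈1 + α⌉₊ := Nat.le_ceil _
    have ha0 : 0 < ⌈1 + α⌉₊ := Nat.ceil_pos.2 (by linarith)
    exact ⟨_, by positivity, 32 * ⌈1 + α⌉₊ + 3, by positivity, 2, fun S Q hSQ n hn =>
      reporting_lower_bound ha ha0 hn (hSQ.imp (fun h => h n) fun h => h n)⟩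
  · exact ⟨1 / 2 ^ 20, by positivity, 2, fun μ G _ hG S Q hSQ n hn =>
      searching_lower_bound hG hn (hSQ.imp (fun h => h n) fun h => h n)⟩
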